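/- **Proposition 7.1.** Let $k\ge 1$ be an integer, $p=2k$, and $0<l<\infty$. Let $W_2^p(0,l)$ be the set of functions $y\in L^2(0,l)$ (complex valued) such that $y,y',\dots,y^{(p-1)}$ exist and are absolutely continuous on $[0,l]$ and $y^{(p)}\in L^2(0,l)$. For $y\in W_2^p(0,l)$ and $x\in[0,l]$ put $$Y_0(x)=\operatorname{col}\big(y(x),y'(x),\dots,y^{(k-1)}(x)\big),\qquad Y_1(x)=\operatorname{col}\big(y^{(k)}(x),y^{(k+1)}(x),\dots,y^{(2k-1)}(x)\big)\in\mathbb{C}^k,$$ and let $J_k$ be the $k\times k$ antidiagonal matrix whose entries, read from the top right corner to the bottom left corner, are $1,-1,\dots,(-1)^{k-1}$, that is, $(J_k)_{i,\,k+1-i}=(-1)^{i-1}$ for $1\le i\le k$, all other entries being $0$. Let $B_0$ and $B_l$ be arbitrary self-adjoint (complex Hermitian) $k\times k$ matrices. Then the operator $y\mapsto(-iD)^{p}y=(-i)^{p}y^{(p)}$ in the Hilbert space $L^2(0,l)$, with domain the set of all $y\in W_2^p(0,l)$ satisfying the separated boundary conditions $$J_kY_1(0)=B_0Y_0(0),\qquad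 J_kY_1(l)=B_lY_0(l),$$ is self-adjoint. -/

import Mathlib

open MeasureTheory Set

noncomputable section

namespace HighOrderOp

/-- Lebesgue measure on the interval `(0, l)`. -/
abbrev intervalMeasure (l : ℝ) : Measure ℝ := volume.restrict (Ioo 0 l)

/-- The complex Hilbert space `L²(0, l)`. -/
abbrev L2 (l : ℝ) : Type := Lp ℂ 2 (intervalMeasure l)

/-- The `j`-th derivative of `u` on the closed interval `[0, l]` (one-sided at the endpoints). -/
abbrev nderiv (l : ℝ) (j : ℕ) (u : ℝ → ℂ) : ℝ → ℂ := iteratedDerivWithin j u (Icc 0 l)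

/-- `u` is (the continuous representative of) an element of the Sobolev space `W₂ᵖ(0, l)`:
`u, u', …, u⁽ᵖ⁻¹⁾` exist everywhere on `[0, l]` and are absolutely continuous there, and the
`p`-th derivative, which therefore exists almost everywhere, is square integrable. -/
structure IsSobolev (p : ℕ) (l : ℝ) (u : ℝ → ℂ) : Prop where
  differentiableOn : ∀ j, j + 1 < p → DifferentiableOn ℝ (nderiv l j u) (Icc 0 l)
  absolutelyContinuous : ∀ j, j < p → AbsolutelyContinuousOnInterval (nderiv l j u) 0 l
  memLp : MemLp (nderiv l p u) 2 (intervalMeasure l)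

/-- The `k × k` antidiagonal matrix with entries `1, -1, …, (-1)^(k-1)`, listed from the top right
corner to the bottom left corner. -/
def J (k : ℕ) : Matrix (Fin k) (Fin k) ℂ :=
  Matrix.of fun i j => if (i : ℕ) + (j : ℕ) + 1 = k then (-1) ^ (i : ℕ) else 0

/-- `Y₀(x) = col (y(x), y'(x), …, y⁽ᵏ⁻¹⁾(x))`. -/
def Y0 (k : ℕ) (l : ℝ) (y : ℝ → ℂ) (x : ℝ) : Fin k → ℂ := fun i => nderiv l i y x

/-- `Y₁(x) = col (y⁽ᵏ⁾(x), y⁽ᵏ⁺¹⁾(x), …, y⁽²ᵏ⁻¹⁾(x))`. -/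
def Y1 (k : ℕ) (l : ℝ) (y : ℝ → ℂ) (x : ℝ) : Fin k → ℂ := fun i => nderiv l (k + i) y x

/-- The separated boundary conditions `J_k Y₁(0) = B₀ Y₀(0)`, `J_k Y₁(l) = B_l Y₀(l)`. -/
def SeparatedBC (k : ℕ) (l : ℝ) (B₀ Bl : Matrix (Fin k) (Fin k) ℂ) (y : ℝ → ℂ) : Prop :=
  (J k).mulVec (Y1 k l y 0) = B₀.mulVec (Y0 k l y 0) ∧
    (J k).mulVec (Y1 k l y l) = Bl.mulVec (Y0 k l y l)

/-- The functions in `W₂²ᵏ(0, l)` satisfying the separated boundary conditions. -/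
structure InDomain (k : ℕ) (l : ℝ) (B₀ Bl : Matrix (Fin k) (Fin k) ℂ) (y : ℝ → ℂ) : Prop where
  sobolev : IsSobolev (2 * k) l y
  bc : SeparatedBC k l B₀ Bl y

theorem nderiv_zero_fun (l : ℝ) (j : ℕ) : nderiv l j (0 : ℝ → ℂ) = 0 := by
  funext x
  simp [nderiv]

theorem nderiv_smul (l : ℝ) (j : ℕ) (c : ℂ) (u : ℝ → ℂ) :
    nderiv l j (c • u) = c • nderiv l j u := by
  funext x
  exact iteratedDerivWithin_const_smul_field c u

theorem nderiv_add {p : ℕ} {l : ℝ} {u v : ℝ → ℂ} (hu : IsSobolev p l u)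
    (hv : IsSobolev p l v) : ∀ j, j < p →
    EqOn (nderiv l j (u + v)) (nderiv l j u + nderiv l j v) (Icc 0 l) := by
  intro j
  induction j with
  | zero => intro _ x _; simp [nderiv]
  | succ j ih =>
    intro hj x hx
    have e := ih (by omega)
    simp only [nderiv, iteratedDerivWithin_succ, Pi.add_apply] at e ⊢
    rw [derivWithin_congr e (e hx)]
    exact derivWithin_add (hu.differentiableOn j hj x hx) (hv.differentiableOn j hj x hx)

theorem ae_differentiableWithinAt {l : ℝ} (hl : 0 < l) {f : ℝ → ℂ}
    (hf : AbsolutelyContinuousOnInterval f 0 l) :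
    ∀ᵐ x ∂(intervalMeasure l), DifferentiableWithinAt ℝ f (Icc 0 l) x := by
  rw [ae_restrict_iff' measurableSet_Ioo]
  filter_upwards [hf.boundedVariationOn.ae_differentiableAt_of_mem_uIcc] with x hx hm
  refine (hx ?_).differentiableWithinAt
  rw [uIcc_of_le hl.le]
  exact Ioo_subset_Icc_self hm

theorem nderiv_add_ae {p : ℕ} {l : ℝ} (hl : 0 < l) {u v : ℝ → ℂ} (hu : IsSobolev p l u)
    (hv : IsSobolev p l v) :
    nderiv l p (u + v) =ᵐ[intervalMeasure l] nderiv l p u + nderiv l p v := by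
  cases p with
  | zero => simp [nderiv, iteratedDerivWithin_zero]
  | succ n =>
    filter_upwards [ae_differentiableWithinAt hl (hu.absolutelyContinuous n (by omega)),
      ae_differentiableWithinAt hl (hv.absolutelyContinuous n (by omega)),
      ae_restrict_mem measurableSet_Ioo] with x h1 h2 hx
    have e := nderiv_add hu hv n (by omega)
    simp only [nderiv, iteratedDerivWithin_succ, Pi.add_apply] at e h1 h2 ⊢
    rw [derivWithin_congr e (e (Ioo_subset_Icc_self hx))]
    exact derivWithin_add h1 h2

theorem AbsCont.congr {l : ℝ} (hl : 0 < l) {f g : ℝ → ℂ}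
    (hf : AbsolutelyContinuousOnInterval f 0 l) (h : EqOn g f (Icc 0 l)) :
    AbsolutelyContinuousOnInterval g 0 l := by
  rw [absolutelyContinuousOnInterval_iff] at hf ⊢
  intro ε hε
  obtain ⟨δ, hδ, H⟩ := hf ε hε
  refine ⟨δ, hδ, fun E hE hs => ?_⟩
  have := H E hE hs
  convert this using 2 with i hi
  have hm := hE.1 i (by simpa using hi)
  rw [uIcc_of_le hl.le] at hm
  rw [h hm.1, h hm.2]

theorem IsSobolev.zero (p : ℕ) (l : ℝ) : IsSobolev p l 0 where
  differentiableOn j _ := by rw [nderiv_zero_fun]; exact differentiableOn_const 0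
  absolutelyContinuous j _ := by
    rw [nderiv_zero_fun]
    exact (contDiffOn_const (c := (0 : ℂ))).absolutelyContinuousOnInterval
  memLp := by rw [nderiv_zero_fun]; exact MemLp.zero

theorem IsSobolev.smul {p : ℕ} {l : ℝ} {u : ℝ → ℂ} (c : ℂ) (hu : IsSobolev p l u) :
    IsSobolev p l (c • u) where
  differentiableOn j hj := by rw [nderiv_smul]; exact (hu.differentiableOn j hj).const_smul c
  absolutelyContinuous j hj := by
    rw [nderiv_smul]; exact (hu.absolutelyContinuous j hj).const_smul c
  memLp := by rw [nderiv_smul]; exact hu.memLp.const_smul c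

theorem IsSobolev.add {p : ℕ} {l : ℝ} (hl : 0 < l) {u v : ℝ → ℂ} (hu : IsSobolev p l u)
    (hv : IsSobolev p l v) : IsSobolev p l (u + v) where
  differentiableOn j hj :=
    ((hu.differentiableOn j hj).add (hv.differentiableOn j hj)).congr
      (nderiv_add hu hv j (by omega))
  absolutelyContinuous j hj :=
    AbsCont.congr hl ((hu.absolutelyContinuous j hj).add (hv.absolutelyContinuous j hj))
      (nderiv_add hu hv j hj)
  memLp := (memLp_congr_ae (nderiv_add_ae hl hu hv)).2 (hu.memLp.add hv.memLp)

theorem InDomain.zero {k : ℕ} (l : ℝ) (B₀ Bl : Matrix (Fin k) (Fin k) ℂ) :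
    InDomain k l B₀ Bl 0 := by
  have h0 : ∀ x, Y0 k l 0 x = 0 := fun x => by funext i; simp [Y0]
  have h1 : ∀ x, Y1 k l 0 x = 0 := fun x => by funext i; simp [Y1]
  exact ⟨IsSobolev.zero _ _, by simp [h0, h1], by simp [h0, h1]⟩

theorem InDomain.smul {k : ℕ} {l : ℝ} {B₀ Bl : Matrix (Fin k) (Fin k) ℂ} {u : ℝ → ℂ} (c : ℂ)
    (hu : InDomain k l B₀ Bl u) : InDomain k l B₀ Bl (c • u) := by
  have h0 : ∀ x, Y0 k l (c • u) x = c • Y0 k l u x := fun x => by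
    funext i; simp [Y0]
  have h1 : ∀ x, Y1 k l (c • u) x = c • Y1 k l u x := fun x => by
    funext i; simp [Y1]
  refine ⟨hu.sobolev.smul c, ?_, ?_⟩
  · simp only [h0, h1, Matrix.mulVec_smul, hu.bc.1]
  · simp only [h0, h1, Matrix.mulVec_smul, hu.bc.2]

theorem InDomain.add {k : ℕ} {l : ℝ} (hl : 0 < l) {B₀ Bl : Matrix (Fin k) (Fin k) ℂ}
    {u v : ℝ → ℂ} (hu : InDomain k l B₀ Bl u) (hv : InDomain k l B₀ Bl v) :
    InDomain k l B₀ Bl (u + v) := by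
  have h0 : ∀ x ∈ Icc 0 l, Y0 k l (u + v) x = Y0 k l u x + Y0 k l v x := fun x hx => by
    funext i; exact nderiv_add hu.sobolev hv.sobolev i (by omega) hx
  have h1 : ∀ x ∈ Icc 0 l, Y1 k l (u + v) x = Y1 k l u x + Y1 k l v x := fun x hx => by
    funext i; exact nderiv_add hu.sobolev hv.sobolev (k + i) (by omega) hx
  have m0 : (0 : ℝ) ∈ Icc 0 l := ⟨le_rfl, hl.le⟩
  have ml : l ∈ Icc 0 l := ⟨hl.le, le_rfl⟩
  refine ⟨hu.sobolev.add hl hv.sobolev, ?_, ?_⟩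
  · rw [h0 0 m0, h1 0 m0, Matrix.mulVec_add, Matrix.mulVec_add, hu.bc.1, hv.bc.1]
  · rw [h0 l ml, h1 l ml, Matrix.mulVec_add, Matrix.mulVec_add, hu.bc.2, hv.bc.2]

/-- Two Sobolev functions that agree almost everywhere have the same `p`-th derivative. -/
theorem nderiv_congr_ae {p : ℕ} {l : ℝ} (hl : 0 < l) {u v : ℝ → ℂ} (hu : IsSobolev p l u)
    (hv : IsSobolev p l v) (h : u =ᵐ[intervalMeasure l] v) :
    nderiv l p u =ᵐ[intervalMeasure l] nderiv l p v := by
  cases p with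
  | zero => simpa [nderiv, iteratedDerivWithin_zero] using h
  | succ n =>
    have cu := (hu.absolutelyContinuous 0 (by omega)).continuousOn
    have cv := (hv.absolutelyContinuous 0 (by omega)).continuousOn
    simp only [nderiv, iteratedDerivWithin_zero, uIcc_of_le hl.le] at cu cv
    have e : EqOn u v (Icc 0 l) := by
      refine Measure.eqOn_Icc_of_ae_eq volume hl.ne ?_ cu cv
      rwa [Measure.restrict_congr_set Ioo_ae_eq_Icc.symm]
    filter_upwards [ae_restrict_mem measurableSet_Ioo] with x hx
    exact iteratedDerivWithin_congr e (Ioo_subset_Icc_self hx)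

/-- The domain in `L²(0, l)`: the classes of the functions in `W₂²ᵏ(0, l)` that satisfy the
separated boundary conditions. -/
def domain (k : ℕ) {l : ℝ} (hl : 0 < l) (B₀ Bl : Matrix (Fin k) (Fin k) ℂ) :
    Submodule ℂ (L2 l) where
  carrier := {f | ∃ y : ℝ → ℂ, InDomain k l B₀ Bl y ∧ f =ᵐ[intervalMeasure l] y}
  zero_mem' := ⟨0, InDomain.zero l B₀ Bl, Lp.coeFn_zero _ _ _⟩
  add_mem' := by
    rintro f g ⟨u, hu, hfu⟩ ⟨v, hv, hgv⟩
    exact ⟨u + v, hu.add hl hv, (Lp.coeFn_add f g).trans (hfu.add hgv)⟩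
  smul_mem' := by
    rintro c f ⟨u, hu, hfu⟩
    exact ⟨c • u, hu.smul c, (Lp.coeFn_smul c f).trans (hfu.const_smul c)⟩

/-- The representative in `W₂²ᵏ(0, l)` of an element of the domain. -/
def rep {k : ℕ} {l : ℝ} {hl : 0 < l} {B₀ Bl : Matrix (Fin k) (Fin k) ℂ}
    (f : domain k hl B₀ Bl) : ℝ → ℂ := f.2.choose

theorem rep_inDomain {k : ℕ} {l : ℝ} {hl : 0 < l} {B₀ Bl : Matrix (Fin k) (Fin k) ℂ}
    (f : domain k hl B₀ Bl) : InDomain k l B₀ Bl (rep f) := f.2.choose_spec.1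

theorem coe_ae_eq_rep {k : ℕ} {l : ℝ} {hl : 0 < l} {B₀ Bl : Matrix (Fin k) (Fin k) ℂ}
    (f : domain k hl B₀ Bl) : (f : L2 l) =ᵐ[intervalMeasure l] rep f := f.2.choose_spec.2

/-- The operator `(-iD)²ᵏ : y ↦ (-i)²ᵏ y⁽²ᵏ⁾` in `L²(0, l)`, on the functions that satisfy the
separated boundary conditions. -/
def separatedOp (k : ℕ) {l : ℝ} (hl : 0 < l) (B₀ Bl : Matrix (Fin k) (Fin k) ℂ) :
    L2 l →ₗ.[ℂ] L2 l where
  domain := domain k hl B₀ Bl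
  toFun :=
    { toFun := fun f =>
        (-Complex.I) ^ (2 * k) • (rep_inDomain f).sobolev.memLp.toLp (nderiv l (2 * k) (rep f))
      map_add' := fun f g => by
        have hf := (rep_inDomain f).sobolev
        have hg := (rep_inDomain g).sobolev
        rw [← smul_add, ← MemLp.toLp_add]
        congr 1
        refine MemLp.toLp_congr _ _ ?_
        refine (nderiv_congr_ae hl (rep_inDomain (f + g)).sobolev (hf.add hl hg) ?_).trans
          (nderiv_add_ae hl hf hg)
        exact (coe_ae_eq_rep (f + g)).symm.trans
          ((Lp.coeFn_add (f : L2 l) (g : L2 l)).trans ((coe_ae_eq_rep f).add (coe_ae_eq_rep g)))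
      map_smul' := fun c f => by
        have hf := (rep_inDomain f).sobolev
        rw [RingHom.id_apply, smul_comm c, ← MemLp.toLp_const_smul c hf.memLp]
        congr 1
        refine MemLp.toLp_congr (rep_inDomain (c • f)).sobolev.memLp (hf.memLp.const_smul c) ?_
        refine (nderiv_congr_ae hl (rep_inDomain (c • f)).sobolev (hf.smul c) ?_).trans
          (Filter.EventuallyEq.of_eq (nderiv_smul l (2 * k) c (rep f)))
        exact (coe_ae_eq_rep (c • f)).symm.trans
          ((Lp.coeFn_smul c (f : L2 l)).trans ((coe_ae_eq_rep f).const_smul c)) }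

/-- The value of the operator can be computed from any representative. -/
theorem separatedOp_apply {k : ℕ} {l : ℝ} {hl : 0 < l} {B₀ Bl : Matrix (Fin k) (Fin k) ℂ}
    (f : (separatedOp k hl B₀ Bl).domain) {y : ℝ → ℂ} (hy : InDomain k l B₀ Bl y)
    (h : (f : L2 l) =ᵐ[intervalMeasure l] y) :
    (separatedOp k hl B₀ Bl f : L2 l) =ᵐ[intervalMeasure l]
      fun x => (-Complex.I) ^ (2 * k) * nderiv l (2 * k) y x := by
  have h1 := nderiv_congr_ae hl (rep_inDomain (hl := hl) f).sobolev hy.sobolev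
    ((coe_ae_eq_rep (hl := hl) f).symm.trans h)
  have h2 := (rep_inDomain (hl := hl) f).sobolev.memLp.coeFn_toLp
  have h3 := Lp.coeFn_smul ((-Complex.I) ^ (2 * k))
    ((rep_inDomain (hl := hl) f).sobolev.memLp.toLp (nderiv l (2 * k) (rep (hl := hl) f)))
  filter_upwards [h1, h2, h3] with x e1 e2 e3
  refine e3.trans ?_
  rw [Pi.smul_apply, e2, e1, smul_eq_mul]

end HighOrderOp

end

open MeasureTheory Set

noncomputable section

namespace HighOrderOp

open ComplexConjugate ComplexOrder

/-! Write p = 2k. Integration by parts (`lagrange_identity`) moves p derivatives from u to v at the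
cost of a boundary form at 0 and at l. In terms of the boundary vectors this form is ⟨J Y₁(u),
Y₀(v)⟩ - ⟨Y₀(u), J Y₁(v)⟩ (`lagrangeForm_two_mul`). If u satisfies the condition with Hermitian B,
it becomes ⟨Y₀(u), B Y₀(v) - J Y₁(v)⟩, which vanishes when v satisfies it too. So the operator is
symmetric.

Conversely, suppose ⟨Af, z⟩ = ⟨f, w⟩ for all f in the domain. Testing with functions whose data
vanish at both ends shows that z differs from a solution of u⁽ᵖ⁾ = (-1)ᵏ w by an element of N⊥⊥,
where N is the space of solutions of u⁽ᵖ⁾ = 0: every element of N⊥ is the p-th derivative of such a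
test function (`exists_isSobolev_of_mem_orthogonal`). As N is finite dimensional, N⊥⊥ = N and z is
Sobolev (`exists_isSobolev_of_weak`). Testing next with domain elements having arbitrary Y₀ at one
end and zero data at the other forces the boundary conditions on z (`separatedBC_of_forall`). The
case z = 0 gives w = 0, hence density of the domain. -/

/-! ### Absolute continuity and the fundamental theorem of calculus -/

theorem absolutelyContinuousOnInterval_const {X : Type*} [PseudoMetricSpace X] (c : X) (a b : ℝ) :
    AbsolutelyContinuousOnInterval (fun _ => c) a b :=
  (LipschitzWith.const c).lipschitzOnWith.absolutelyContinuousOnInterval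

/-- The primitive of an integrable complex function is absolutely continuous. -/
theorem absolutelyContinuousOnInterval_primitive {f : ℝ → ℂ} {a b c : ℝ}
    (h : IntervalIntegrable f volume a b) (hc : c ∈ uIcc a b) :
    AbsolutelyContinuousOnInterval (fun x ↦ ∫ v in c..x, f v) a b := by
  have hre : IntervalIntegrable (fun x => (f x).re) volume a b := ⟨h.1.re, h.2.re⟩
  have him : IntervalIntegrable (fun x => (f x).im) volume a b := ⟨h.1.im, h.2.im⟩
  -- The constants 1 and I carry the real-valued primitives of the real and imaginary parts into ℂ.
  have h1 := (hre.absolutelyContinuousOnInterval_intervalIntegral hc).fun_smul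
    (absolutelyContinuousOnInterval_const (1 : ℂ) a b)
  have h2 := (him.absolutelyContinuousOnInterval_intervalIntegral hc).fun_smul
    (absolutelyContinuousOnInterval_const Complex.I a b)
  have h12 := h1.add h2
  rw [absolutelyContinuousOnInterval_iff] at h12 ⊢
  intro ε hε
  obtain ⟨δ, hδ, H⟩ := h12 ε hε
  refine ⟨δ, hδ, fun E hE hs => ?_⟩
  have key : ∀ x ∈ uIcc a b, ∫ v in c..x, f v =
      (∫ v in c..x, (f v).re) • (1 : ℂ) + (∫ v in c..x, (f v).im) • Complex.I := by
    intro x hx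
    have hcx : IntervalIntegrable f volume c x := h.mono_set (uIcc_subset_uIcc hc hx)
    have e1 := Complex.reCLM.intervalIntegral_comp_comm hcx
    have e2 := Complex.imCLM.intervalIntegral_comp_comm hcx
    simp only [Complex.reCLM_apply, Complex.imCLM_apply] at e1 e2
    rw [e1, e2]
    apply Complex.ext <;> simp
  convert H E hE hs using 2 with i hi
  have hm := hE.1 i (by simpa using hi)
  simp only [Pi.add_apply]
  rw [key _ hm.1, key _ hm.2]

/-- Subtracting the primitive of `f'` leaves an absolutely continuous function with zero derivative
almost everywhere, hence a constant. -/
theorem integral_eq_sub_of_absolutelyContinuous {f f' : ℝ → ℂ} {a b : ℝ}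
    (hf : AbsolutelyContinuousOnInterval f a b) (hi : IntervalIntegrable f' volume a b)
    (hd : ∀ᵐ x, x ∈ uIcc a b → HasDerivAt f (f' x) x) :
    ∫ x in a..b, f' x = f b - f a := by
  have hg := hf.fun_sub (absolutelyContinuousOnInterval_primitive hi left_mem_uIcc)
  obtain ⟨C, hC⟩ := hg.const_of_ae_hasDerivAt_zero (by
    filter_upwards [hd, hi.ae_hasDerivAt_integral] with x h1 h2 hx
    simpa using (h1 hx).fun_sub (h2 hx a left_mem_uIcc))
  have ha := hC a left_mem_uIcc
  have hb := hC b right_mem_uIcc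
  simp only [intervalIntegral.integral_same, sub_zero] at ha hb
  rw [ha, ← hb]; ring

theorem uniqueDiffOn_Icc_zero {l : ℝ} (hl : 0 < l) : UniqueDiffOn ℝ (Icc 0 l) :=
  uniqueDiffOn_Icc hl

theorem ae_uIcc_of_ae_interval {l : ℝ} (hl : 0 < l) {P : ℝ → Prop}
    (h : ∀ᵐ x ∂(intervalMeasure l), P x) : ∀ᵐ x, x ∈ uIcc 0 l → P x := by
  rw [uIcc_of_le hl.le, ← ae_restrict_iff' measurableSet_Icc,
    ← Measure.restrict_congr_set Ioo_ae_eq_Icc]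
  exact h

theorem integral_intervalMeasure {l : ℝ} (hl : 0 < l) (f : ℝ → ℂ) :
    ∫ x, f x ∂(intervalMeasure l) = ∫ x in (0 : ℝ)..l, f x := by
  rw [intervalIntegral.integral_of_le hl.le, ← integral_Ioc_eq_integral_Ioo]

theorem integrable_iff_intervalIntegrable {l : ℝ} (hl : 0 < l) {f : ℝ → ℂ} :
    Integrable f (intervalMeasure l) ↔ IntervalIntegrable f volume 0 l := by
  rw [intervalIntegrable_iff_integrableOn_Ioo_of_le hl.le]
  rfl

theorem memLp_of_continuousOn {l : ℝ} {f : ℝ → ℂ}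
    (hf : ContinuousOn f (Icc 0 l)) : MemLp f 2 (intervalMeasure l) := by
  obtain ⟨C, hC⟩ := isCompact_Icc.exists_bound_of_continuousOn hf
  refine MemLp.of_bound ((hf.mono Ioo_subset_Icc_self).aestronglyMeasurable measurableSet_Ioo) C ?_
  filter_upwards [ae_restrict_mem measurableSet_Ioo] with x hx
  exact hC x (Ioo_subset_Icc_self hx)

/-! ### Sobolev functions and initial value problems -/

theorem IsSobolev.continuousOn {p : ℕ} {l : ℝ} (hl : 0 < l) {u : ℝ → ℂ} (hu : IsSobolev p l u)
    {j : ℕ} (hj : j < p) : ContinuousOn (nderiv l j u) (Icc 0 l) := by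
  simpa [uIcc_of_le hl.le] using (hu.absolutelyContinuous j hj).continuousOn

theorem IsSobolev.memLp_nderiv {p : ℕ} {l : ℝ} (hl : 0 < l) {u : ℝ → ℂ} (hu : IsSobolev p l u)
    {j : ℕ} (hj : j ≤ p) : MemLp (nderiv l j u) 2 (intervalMeasure l) := by
  rcases hj.lt_or_eq with h | rfl
  · exact memLp_of_continuousOn (hu.continuousOn hl h)
  · exact hu.memLp

theorem IsSobolev.memLp_self {p : ℕ} {l : ℝ} (hl : 0 < l) {u : ℝ → ℂ} (hu : IsSobolev p l u) :
    MemLp u 2 (intervalMeasure l) := by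
  simpa [nderiv] using hu.memLp_nderiv hl (Nat.zero_le p)

theorem IsSobolev.ae_hasDerivAt {p : ℕ} {l : ℝ} (hl : 0 < l) {u : ℝ → ℂ} (hu : IsSobolev p l u)
    {j : ℕ} (hj : j < p) :
    ∀ᵐ x ∂(intervalMeasure l), HasDerivAt (nderiv l j u) (nderiv l (j + 1) u x) x := by
  filter_upwards [ae_differentiableWithinAt hl (hu.absolutelyContinuous j hj),
    ae_restrict_mem measurableSet_Ioo] with x h1 hx
  have h2 := h1.hasDerivWithinAt.hasDerivAt (Icc_mem_nhds hx.1 hx.2)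
  simp only [nderiv, iteratedDerivWithin_succ]
  exact h2

/-- The initial value problem `u⁽ᵖ⁾ = 0`, `u⁽ʲ⁾(t) = 0` for `j < p` has only the zero solution. -/
theorem IsSobolev.eqOn_zero {p : ℕ} {l : ℝ} (hl : 0 < l) {u : ℝ → ℂ} (hu : IsSobolev p l u)
    (h0 : nderiv l p u =ᵐ[intervalMeasure l] 0) {t : ℝ} (ht : t ∈ Icc 0 l)
    (hd : ∀ j < p, nderiv l j u t = 0) {j : ℕ} (hj : j < p) : EqOn (nderiv l j u) 0 (Icc 0 l) := by
  -- Induction descends from the top derivative: `i` counts down from order p - 1.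
  have main : ∀ i, i < p → EqOn (nderiv l (p - 1 - i) u) 0 (Icc 0 l) := by
    intro i
    have step : ∀ j, j < p → nderiv l (j + 1) u =ᵐ[intervalMeasure l] 0 →
        EqOn (nderiv l j u) 0 (Icc 0 l) := by
      intro j hj h
      obtain ⟨C, hC⟩ := (hu.absolutelyContinuous j hj).const_of_ae_hasDerivAt_zero
        (ae_uIcc_of_ae_interval hl (by
          filter_upwards [h, hu.ae_hasDerivAt hl hj] with x h1 h2
          rw [h1] at h2
          exact h2))
      rw [uIcc_of_le hl.le] at hC
      intro x hx
      rw [hC x hx, ← hC t ht, hd j hj]; rfl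
    induction i with
    | zero =>
      intro hp
      exact step _ (by omega) (by rwa [show p - 1 - 0 + 1 = p by omega])
    | succ i ih =>
      intro hi
      refine step _ (by omega) ?_
      rw [show p - 1 - (i + 1) + 1 = p - 1 - i by omega]
      filter_upwards [ae_restrict_mem measurableSet_Ioo] with x hx
      exact ih (by omega) (Ioo_subset_Icc_self hx)
  have := main (p - 1 - j) (by omega)
  rwa [show p - 1 - (p - 1 - j) = j by omega] at this

/-- A function with continuous derivative on `[0, l]` gains one order of Sobolev regularity. -/
theorem IsSobolev.of_hasDerivWithinAt {p : ℕ} {l : ℝ} (hl : 0 < l) {u U : ℝ → ℂ}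
    (hp : 0 < p) (hu : IsSobolev p l u)
    (hU : ∀ x ∈ Icc 0 l, HasDerivWithinAt U (u x) (Icc 0 l) x) :
    IsSobolev (p + 1) l U ∧ ∀ j, EqOn (nderiv l (j + 1) U) (nderiv l j u) (Icc 0 l) := by
  have hud := uniqueDiffOn_Icc_zero hl
  have hder : EqOn (derivWithin U (Icc 0 l)) u (Icc 0 l) := fun x hx =>
    (hU x hx).derivWithin (hud x hx)
  have hj : ∀ j, EqOn (nderiv l (j + 1) U) (nderiv l j u) (Icc 0 l) := by
    intro j x hx
    simp only [nderiv, iteratedDerivWithin_succ']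
    exact iteratedDerivWithin_congr hder hx
  have hc : ContinuousOn u (Icc 0 l) := by simpa [nderiv] using hu.continuousOn hl hp
  refine ⟨⟨?_, ?_, ?_⟩, hj⟩
  · rintro (_ | j) h
    · simp only [nderiv, iteratedDerivWithin_zero]
      exact fun x hx => (hU x hx).differentiableWithinAt
    · exact (hu.differentiableOn j (by omega)).congr (hj j)
  · rintro (_ | j) h
    · have : ContDiffOn ℝ 1 U (Icc 0 l) := by
        rw [contDiffOn_one_iff_derivWithin hud]
        exact ⟨fun x hx => (hU x hx).differentiableWithinAt, hc.congr hder⟩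
      rw [← uIcc_of_le hl.le] at this
      simpa [nderiv] using this.absolutelyContinuousOnInterval
    · exact AbsCont.congr hl (hu.absolutelyContinuous j (by omega)) (hj j)
  · refine (memLp_congr_ae ?_).2 hu.memLp
    filter_upwards [ae_restrict_mem measurableSet_Ioo] with x hx
    exact hj p (Ioo_subset_Icc_self hx)

/-- The initial value problem `u⁽ᵖ⁾ = q`, `u⁽ʲ⁾(t) = a j` for `j < p` is solvable. -/
theorem exists_isSobolev {l : ℝ} (hl : 0 < l) {q : ℝ → ℂ} (hq : MemLp q 2 (intervalMeasure l))
    {t : ℝ} (ht : t ∈ Icc 0 l) (n : ℕ) (a : ℕ → ℂ) :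
    ∃ u, IsSobolev (n + 1) l u ∧ nderiv l (n + 1) u =ᵐ[intervalMeasure l] q ∧
      ∀ j < n + 1, nderiv l j u t = a j := by
  have htu : t ∈ uIcc 0 l := by rwa [uIcc_of_le hl.le]
  induction n generalizing a with
  | zero =>
    have hqi : IntervalIntegrable q volume 0 l :=
      (integrable_iff_intervalIntegrable hl).1 (hq.integrable (by norm_num))
    have hq1 : nderiv l (0 + 1) (fun x => a 0 + ∫ v in t..x, q v) =ᵐ[intervalMeasure l] q := by
      have h1 := hqi.ae_hasDerivAt_integral
      filter_upwards [ae_restrict_of_ae h1, ae_restrict_mem measurableSet_Ioo] with x h2 hx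
      have hx' := Ioo_subset_Icc_self hx
      have h3 := (h2 (by rwa [uIcc_of_le hl.le]) t htu).const_add (a 0)
      simp only [nderiv, zero_add, iteratedDerivWithin_one]
      exact h3.hasDerivWithinAt.derivWithin (uniqueDiffOn_Icc_zero hl x hx')
    refine ⟨fun x => a 0 + ∫ v in t..x, q v, ⟨fun j hj => by omega, fun j hj => ?_, ?_⟩, hq1, ?_⟩
    · obtain rfl : j = 0 := by omega
      simp only [nderiv, iteratedDerivWithin_zero]
      exact (absolutelyContinuousOnInterval_const (a 0) 0 l).fun_add
        (absolutelyContinuousOnInterval_primitive hqi htu)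
    · exact (memLp_congr_ae hq1).2 hq
    · intro j hj
      obtain rfl : j = 0 := by omega
      simp [nderiv]
  | succ n ih =>
    obtain ⟨u, hu, hup, hua⟩ := ih (fun j => a (j + 1))
    have hc : ContinuousOn u (Icc 0 l) := by simpa [nderiv] using hu.continuousOn hl n.succ_pos
    have hU : ∀ x ∈ Icc 0 l,
        HasDerivWithinAt (fun x => a 0 + ∫ v in t..x, u v) (u x) (Icc 0 l) x := by
      intro x hx
      refine HasDerivWithinAt.const_add _ ?_
      -- Needed by the instance that supplies the one-sided fundamental theorem within a closed
      -- interval.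
      have : Fact (x ∈ Icc 0 l) := ⟨hx⟩
      refine intervalIntegral.integral_hasDerivWithinAt_right ?_ ?_ (hc x hx)
      · exact (hc.mono (uIcc_subset_Icc ht hx)).intervalIntegrable
      · exact ⟨Icc 0 l, self_mem_nhdsWithin, hc.aestronglyMeasurable measurableSet_Icc⟩
    obtain ⟨h1, h2⟩ := IsSobolev.of_hasDerivWithinAt hl n.succ_pos hu hU
    refine ⟨_, h1, ?_, ?_⟩
    · refine Filter.EventuallyEq.trans ?_ hup
      filter_upwards [ae_restrict_mem measurableSet_Ioo] with x hx
      exact h2 (n + 1) (Ioo_subset_Icc_self hx)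
    · rintro (_ | j) hj
      · simp [nderiv]
      · rw [h2 j ht]; exact hua j (by omega)

/-! ### The Lagrange identity -/

/-- The boundary form of the Lagrange identity. -/
def lagrangeForm (l : ℝ) (p : ℕ) (u v : ℝ → ℂ) (x : ℝ) : ℂ :=
  ∑ i ∈ Finset.range p, (-1) ^ i * (conj (nderiv l (p - 1 - i) u x) * nderiv l i v x)

theorem AbsCont.conj {f : ℝ → ℂ} {a b : ℝ} (hf : AbsolutelyContinuousOnInterval f a b) :
    AbsolutelyContinuousOnInterval (fun x => conj (f x)) a b := by
  rw [absolutelyContinuousOnInterval_iff] at hf ⊢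
  intro ε hε
  obtain ⟨δ, hδ, H⟩ := hf ε hε
  refine ⟨δ, hδ, fun E hE hs => ?_⟩
  simpa only [Complex.dist_conj_conj] using H E hE hs

theorem absolutelyContinuousOnInterval_finset_sum {ι : Type*} (s : Finset ι) {f : ι → ℝ → ℂ}
    {a b : ℝ} (hf : ∀ i ∈ s, AbsolutelyContinuousOnInterval (f i) a b) :
    AbsolutelyContinuousOnInterval (fun x => ∑ i ∈ s, f i x) a b := by
  classical
  induction s using Finset.induction_on with
  | empty => simpa using absolutelyContinuousOnInterval_const (0 : ℂ) a b
  | insert i s hi ih =>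
    simp only [Finset.sum_insert hi]
    exact (hf i (Finset.mem_insert_self i s)).fun_add
      (ih fun j hj => hf j (Finset.mem_insert_of_mem hj))

theorem integrable_conj_mul {l : ℝ} {f g : ℝ → ℂ} (hf : MemLp f 2 (intervalMeasure l))
    (hg : MemLp g 2 (intervalMeasure l)) :
    Integrable (fun x => conj (f x) * g x) (intervalMeasure l) :=
  MemLp.integrable_mul (p := 2) (q := 2) hf.star hg

/-- The Lagrange identity for the differential expression `u⁽ᵖ⁾`. -/
theorem lagrange_identity {p : ℕ} {l : ℝ} (hl : 0 < l) {u v : ℝ → ℂ} (hu : IsSobolev p l u)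
    (hv : IsSobolev p l v) :
    ∫ x, conj (nderiv l p u x) * v x ∂(intervalMeasure l) =
      (-1) ^ p * ∫ x, conj (u x) * nderiv l p v x ∂(intervalMeasure l) +
        (lagrangeForm l p u v l - lagrangeForm l p u v 0) := by
  have i1 := integrable_conj_mul hu.memLp (hv.memLp_self hl)
  have i2 := (integrable_conj_mul (hu.memLp_self hl) hv.memLp).const_mul ((-1 : ℂ) ^ p)
  have hac : AbsolutelyContinuousOnInterval (lagrangeForm l p u v) 0 l := by
    refine absolutelyContinuousOnInterval_finset_sum _ fun i hi => ?_
    rw [Finset.mem_range] at hi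
    exact (absolutelyContinuousOnInterval_const ((-1 : ℂ) ^ i) 0 l).fun_smul
      ((AbsCont.conj (hu.absolutelyContinuous (p - 1 - i) (by omega))).fun_smul
        (hv.absolutelyContinuous i hi))
  have hd : ∀ᵐ x ∂(intervalMeasure l), HasDerivAt (lagrangeForm l p u v)
      (conj (nderiv l p u x) * v x - (-1) ^ p * (conj (u x) * nderiv l p v x)) x := by
    have h1 : ∀ᵐ x ∂(intervalMeasure l), ∀ j < p,
        HasDerivAt (nderiv l j u) (nderiv l (j + 1) u x) x := by
      rw [ae_all_iff]; intro j
      by_cases hj : j < p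
      · filter_upwards [hu.ae_hasDerivAt hl hj] with x hx _ using hx
      · exact Filter.Eventually.of_forall fun x h => absurd h hj
    have h2 : ∀ᵐ x ∂(intervalMeasure l), ∀ j < p,
        HasDerivAt (nderiv l j v) (nderiv l (j + 1) v x) x := by
      rw [ae_all_iff]; intro j
      by_cases hj : j < p
      · filter_upwards [hv.ae_hasDerivAt hl hj] with x hx _ using hx
      · exact Filter.Eventually.of_forall fun x h => absurd h hj
    filter_upwards [h1, h2] with x hx1 hx2
    -- By the product rule and the alternating sign, each summand differentiates to a difference of
    -- consecutive terms, so the sum telescopes to its two extreme terms.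
    have hs : HasDerivAt (lagrangeForm l p u v) (∑ i ∈ Finset.range p,
        ((-1) ^ i * (conj (nderiv l (p - i) u x) * nderiv l i v x) -
          (-1) ^ (i + 1) * (conj (nderiv l (p - (i + 1)) u x) * nderiv l (i + 1) v x))) x := by
      refine HasDerivAt.fun_sum fun i hi => ?_
      rw [Finset.mem_range] at hi
      have e1 := (hx1 (p - 1 - i) (by omega)).star
      rw [show p - 1 - i + 1 = p - i by omega] at e1
      have := (e1.fun_mul (hx2 i hi)).const_mul ((-1 : ℂ) ^ i)
      rw [show p - (i + 1) = p - 1 - i by omega]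
      refine this.congr_deriv ?_
      simp only [Complex.star_def]
      ring
    rw [Finset.sum_range_sub'] at hs
    simpa [nderiv] using hs
  have key := integral_eq_sub_of_absolutelyContinuous hac
    ((integrable_iff_intervalIntegrable hl).1 (i1.sub i2)) (ae_uIcc_of_ae_interval hl hd)
  rw [← integral_intervalMeasure hl, integral_sub' i1 i2, integral_const_mul] at key
  rw [← key]; ring

/-! ### The null space of the p-th derivative and weak solutions -/

theorem inner_eq_integral {l : ℝ} {f g : L2 l} {u v : ℝ → ℂ} (hf : f =ᵐ[intervalMeasure l] u)
    (hg : g =ᵐ[intervalMeasure l] v) :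
    inner ℂ f g = ∫ x, conj (u x) * v x ∂(intervalMeasure l) := by
  rw [L2.inner_def]
  refine integral_congr_ae ?_
  filter_upwards [hf, hg] with x h1 h2
  rw [h1, h2, RCLike.inner_apply, mul_comm]

theorem IsSobolev.eqOn_of_ae_eq {p : ℕ} {l : ℝ} (hl : 0 < l) {u v : ℝ → ℂ} (hp : 0 < p)
    (hu : IsSobolev p l u) (hv : IsSobolev p l v) (h : u =ᵐ[intervalMeasure l] v) :
    EqOn u v (Icc 0 l) := by
  have cu := hu.continuousOn hl hp
  have cv := hv.continuousOn hl hp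
  simp only [nderiv, iteratedDerivWithin_zero] at cu cv
  refine Measure.eqOn_Icc_of_ae_eq volume hl.ne ?_ cu cv
  rwa [Measure.restrict_congr_set Ioo_ae_eq_Icc.symm]

theorem IsSobolev.nderiv_eqOn_of_ae_eq {p : ℕ} {l : ℝ} (hl : 0 < l) {u v : ℝ → ℂ} (hp : 0 < p)
    (hu : IsSobolev p l u) (hv : IsSobolev p l v) (h : u =ᵐ[intervalMeasure l] v) (j : ℕ) :
    EqOn (nderiv l j u) (nderiv l j v) (Icc 0 l) := fun _ hx =>
  iteratedDerivWithin_congr (hu.eqOn_of_ae_eq hl hp hv h) hx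

/-- The classes in `L²(0, l)` of the solutions of `u⁽ᵖ⁾ = 0`. -/
def nullSpace (p : ℕ) {l : ℝ} (hl : 0 < l) : Submodule ℂ (L2 l) where
  carrier := {f | ∃ u : ℝ → ℂ, IsSobolev p l u ∧ nderiv l p u =ᵐ[intervalMeasure l] 0 ∧
    f =ᵐ[intervalMeasure l] u}
  zero_mem' := ⟨0, IsSobolev.zero p l, by rw [nderiv_zero_fun], Lp.coeFn_zero _ _ _⟩
  add_mem' := by
    rintro f g ⟨u, hu, hu0, hfu⟩ ⟨v, hv, hv0, hgv⟩
    exact ⟨u + v, hu.add hl hv, (nderiv_add_ae hl hu hv).trans (by simpa using hu0.add hv0),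
      (Lp.coeFn_add f g).trans (hfu.add hgv)⟩
  smul_mem' := by
    rintro c f ⟨u, hu, hu0, hfu⟩
    exact ⟨c • u, hu.smul c, by rw [nderiv_smul]; simpa using hu0.const_smul c,
      (Lp.coeFn_smul c f).trans (hfu.const_smul c)⟩

/-- A solution of u⁽ᵖ⁾ = 0 is determined by its jet at 0, so the jet map embeds the space in ℂᵖ. -/
theorem finiteDimensional_nullSpace {p : ℕ} {l : ℝ} (hp : 0 < p) (hl : 0 < l) :
    FiniteDimensional ℂ (nullSpace p hl) := by
  have m0 : (0 : ℝ) ∈ Icc 0 l := ⟨le_rfl, hl.le⟩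
  choose r hr hr0 hfr using fun f : nullSpace p hl => f.2
  let T : nullSpace p hl →ₗ[ℂ] (Fin p → ℂ) :=
    { toFun := fun f i => nderiv l i (r f) 0
      map_add' := fun f g => by
        funext i
        have h : r (f + g) =ᵐ[intervalMeasure l] r f + r g :=
          (hfr (f + g)).symm.trans
            ((Lp.coeFn_add (f : L2 l) (g : L2 l)).trans ((hfr f).add (hfr g)))
        rw [(hr _).nderiv_eqOn_of_ae_eq hl hp ((hr f).add hl (hr g)) h i m0,
          nderiv_add (hr f) (hr g) i i.2 m0]
        rfl
      map_smul' := fun c f => by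
        funext i
        have h : r (c • f) =ᵐ[intervalMeasure l] c • r f :=
          (hfr (c • f)).symm.trans ((Lp.coeFn_smul c (f : L2 l)).trans ((hfr f).const_smul c))
        rw [(hr _).nderiv_eqOn_of_ae_eq hl hp ((hr f).smul c) h i m0, nderiv_smul]
        rfl }
  refine FiniteDimensional.of_injective T ?_
  rw [← LinearMap.ker_eq_bot, LinearMap.ker_eq_bot']
  intro f hf
  have h := (hr f).eqOn_zero hl (hr0 f) m0 (fun j hj => congrFun hf ⟨j, hj⟩) hp
  apply Subtype.ext
  refine Lp.ext ((hfr f).trans (Filter.EventuallyEq.trans ?_ (Lp.coeFn_zero _ _ _).symm))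
  filter_upwards [ae_restrict_mem measurableSet_Ioo] with x hx
  simpa [nderiv] using h (Ioo_subset_Icc_self hx)

theorem lagrangeForm_eq_zero {l : ℝ} {p : ℕ} {u v : ℝ → ℂ} {x : ℝ}
    (hu : ∀ j < p, nderiv l j u x = 0) : lagrangeForm l p u v x = 0 :=
  Finset.sum_eq_zero fun i hi => by
    rw [hu _ (by rw [Finset.mem_range] at hi; omega)]; simp

/-- A function orthogonal to the solutions of `u⁽ᵖ⁾ = 0` is the `p`-th derivative of a Sobolev
function with zero data at both endpoints. -/
theorem exists_isSobolev_of_mem_orthogonal {p : ℕ} {l : ℝ} (hp : 0 < p) (hl : 0 < l) {q : L2 l}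
    (hq : q ∈ (nullSpace p hl)ᗮ) :
    ∃ y, IsSobolev p l y ∧ nderiv l p y =ᵐ[intervalMeasure l] q ∧
      (∀ j < p, nderiv l j y 0 = 0) ∧ ∀ j < p, nderiv l j y l = 0 := by
  obtain ⟨n, rfl⟩ : ∃ n, p = n + 1 := ⟨p - 1, by omega⟩
  obtain ⟨y, hy, hyq, hy0⟩ := exists_isSobolev hl (Lp.memLp q) ⟨le_rfl, hl.le⟩ n (fun _ => 0)
  refine ⟨y, hy, hyq, hy0, fun j hj => ?_⟩
  -- In the boundary form at l, the derivative of order n - j of the second function is paired with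
  -- the one of order j of `y`. A null solution with this single nonzero datum isolates the j-th
  -- derivative of `y` at l.
  obtain ⟨e, he, he0, hel⟩ := exists_isSobolev hl (q := 0) MemLp.zero ⟨hl.le, le_rfl⟩ n
    (fun i => if i = n - j then 1 else 0)
  have hm : (he.memLp_self hl).toLp e ∈ nullSpace (n + 1) hl :=
    ⟨e, he, he0, MemLp.coeFn_toLp _⟩
  have h1 := Submodule.inner_left_of_mem_orthogonal hm hq
  rw [inner_eq_integral hyq.symm (MemLp.coeFn_toLp _), lagrange_identity hl hy he,
    lagrangeForm_eq_zero hy0] at h1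
  have h2 : ∫ x, conj (y x) * nderiv l (n + 1) e x ∂(intervalMeasure l) = 0 := by
    rw [integral_eq_zero_of_ae]
    filter_upwards [he0] with x hx
    simp [hx]
  rw [h2, lagrangeForm, Finset.sum_eq_single (n - j)] at h1
  · rw [hel _ (by omega), show n + 1 - 1 - (n - j) = j by omega] at h1
    simpa using h1
  · intro i hi hij
    rw [hel i (Finset.mem_range.1 hi), if_neg hij]; simp
  · intro h
    exact absurd (Finset.mem_range.2 (by omega)) h

/-- A weak solution of `z⁽ᵖ⁾ = w` is a Sobolev function. -/
theorem exists_isSobolev_of_weak {p : ℕ} {l : ℝ} (hp : 0 < p) (hl : 0 < l) {z w : L2 l}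
    (h : ∀ y, IsSobolev p l y → (∀ j < p, nderiv l j y 0 = 0) → (∀ j < p, nderiv l j y l = 0) →
      ∫ x, conj (nderiv l p y x) * z x ∂(intervalMeasure l) =
        (-1) ^ p * ∫ x, conj (y x) * w x ∂(intervalMeasure l)) :
    ∃ v, IsSobolev p l v ∧ z =ᵐ[intervalMeasure l] v ∧ nderiv l p v =ᵐ[intervalMeasure l] w := by
  have hu : ∃ u, IsSobolev p l u ∧ nderiv l p u =ᵐ[intervalMeasure l] w := by
    obtain ⟨n, rfl⟩ : ∃ n, p = n + 1 := ⟨p - 1, by omega⟩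
    obtain ⟨u, hu, huw, -⟩ := exists_isSobolev hl (Lp.memLp w) ⟨le_rfl, hl.le⟩ n (fun _ => 0)
    exact ⟨u, hu, huw⟩
  obtain ⟨u, hu, huw⟩ := hu
  have hfin := finiteDimensional_nullSpace hp hl
  have hz : z - (hu.memLp_self hl).toLp u ∈ nullSpace p hl := by
    -- Finite dimension enters here: the null space equals its double orthogonal complement.
    rw [← Submodule.orthogonal_orthogonal (nullSpace p hl), Submodule.mem_orthogonal]
    intro q hq
    obtain ⟨y, hy, hyq, hy0, hyl⟩ := exists_isSobolev_of_mem_orthogonal hp hl hq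
    rw [inner_sub_right, inner_eq_integral hyq.symm (Filter.EventuallyEq.refl _ _),
      inner_eq_integral hyq.symm (MemLp.coeFn_toLp _), h y hy hy0 hyl, lagrange_identity hl hy hu,
      lagrangeForm_eq_zero hy0, lagrangeForm_eq_zero hyl, sub_zero, add_zero, ← mul_sub, sub_eq_zero.2,
      mul_zero]
    refine integral_congr_ae ?_
    filter_upwards [huw] with x hx
    rw [hx]
  obtain ⟨e, he, he0, hze⟩ := hz
  refine ⟨u + e, hu.add hl he, ?_, (nderiv_add_ae hl hu he).trans ?_⟩
  · filter_upwards [hze, Lp.coeFn_sub z ((hu.memLp_self hl).toLp u),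
      MemLp.coeFn_toLp (hu.memLp_self hl)] with x h1 h2 h3
    rw [h2, Pi.sub_apply, h3] at h1
    rw [Pi.add_apply, ← h1]; ring
  · filter_upwards [he0, huw] with x h1 h2
    simp [h1, h2]

/-! ### Prescribing jets at one endpoint -/

theorem IsSobolev.of_contDiff {l : ℝ} (hl : 0 < l) (p : ℕ) {u : ℝ → ℂ}
    (hu : ∀ n : ℕ, ContDiff ℝ n u) : IsSobolev p l u := by
  have hud := uniqueDiffOn_Icc_zero hl
  refine ⟨fun j _ => ?_, fun j _ => ?_, ?_⟩
  · exact ((hu (j + 1)).contDiffOn (s := Icc 0 l)).differentiableOn_iteratedDerivWithin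
      (by exact_mod_cast j.lt_succ_self) hud
  · have h := (hu (j + 1)).contDiffOn (s := Icc 0 l)
    have h2 := ((contDiffOn_nat_succ_iff_contDiffOn_one_iteratedDerivWithin hud).1
      (by exact_mod_cast h)).2
    rw [← uIcc_of_le hl.le] at h2
    have := h2.absolutelyContinuousOnInterval
    rwa [uIcc_of_le hl.le] at this
  · exact memLp_of_continuousOn
      (((hu p).contDiffOn (s := Icc 0 l)).continuousOn_iteratedDerivWithin le_rfl hud)

/-- Smooth functions attain every jet at one point while vanishing near another point. -/
theorem exists_contDiff_jet {t s : ℝ} (hts : t ≠ s) (p : ℕ) (a : ℕ → ℂ) :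
    ∃ f : ℝ → ℂ, (∀ n : ℕ, ContDiff ℝ n f) ∧ (∀ j < p, iteratedDeriv j f t = a j) ∧
      ∀ j, iteratedDeriv j f s = 0 := by
  have hst : s - t ≠ 0 := sub_ne_zero.2 hts.symm
  -- Affine with value 2 at t and -1 at s, so `Real.smoothTransition` of it is 1 near t and 0 near
  -- s. It cuts off the Taylor polynomial `P`.
  let c : ℝ → ℝ := fun x => 2 - 3 * ((x - t) / (s - t))
  let P : ℝ → ℂ := fun x => ∑ j ∈ Finset.range p, (x - t) ^ j • (a j / (j.factorial : ℂ))
  have hc : ∀ n : ℕ, ContDiff ℝ n c := fun n => by fun_prop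
  have hP : ∀ n : ℕ, ContDiff ℝ n P := fun n => by fun_prop
  have hcc : Continuous c := (hc 0).continuous
  refine ⟨fun x => Real.smoothTransition (c x) • P x,
    fun n => (Real.smoothTransition.contDiff.comp (hc n)).smul (hP n), fun j hj => ?_, fun j => ?_⟩
  · have h1 : (fun x => Real.smoothTransition (c x) • P x) =ᶠ[nhds t] P := by
      have : ∀ᶠ x in nhds t, 1 < c x :=
        hcc.continuousAt.eventually (lt_mem_nhds (by simp [c]))
      filter_upwards [this] with x hx
      rw [Real.smoothTransition.one_of_one_le hx.le, one_smul]
    rw [h1.iteratedDeriv_eq, iteratedDeriv_fun_sum (fun i _ => by fun_prop),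
      Finset.sum_eq_single j]
    · rw [iteratedDeriv_smul_const (by fun_prop),
        iteratedDeriv_comp_sub_const (f := fun x : ℝ => x ^ j)]
      simp only [sub_self, iteratedDeriv_fun_pow_zero, if_true]
      rw [Complex.real_smul]
      push_cast
      exact mul_div_cancel₀ _ (Nat.cast_ne_zero.2 j.factorial_ne_zero)
    · intro i _ hij
      rw [iteratedDeriv_smul_const (by fun_prop),
        iteratedDeriv_comp_sub_const (f := fun x : ℝ => x ^ i)]
      simp only [sub_self, iteratedDeriv_fun_pow_zero, hij.symm, if_false, Nat.cast_zero, zero_smul]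
    · intro h; exact absurd (Finset.mem_range.2 hj) h
  · have h1 : (fun x => Real.smoothTransition (c x) • P x) =ᶠ[nhds s] fun _ => 0 := by
      have : ∀ᶠ x in nhds s, c x < 0 :=
        hcc.continuousAt.eventually (gt_mem_nhds (by simp [c, hst]; norm_num))
      filter_upwards [this] with x hx
      rw [Real.smoothTransition.zero_of_nonpos hx.le, zero_smul]
    rw [h1.iteratedDeriv_eq, iteratedDeriv_fun_const_zero]

theorem exists_isSobolev_jet {l : ℝ} (hl : 0 < l) {t s : ℝ} (ht : t ∈ Icc 0 l) (hs : s ∈ Icc 0 l)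
    (hts : t ≠ s) (p : ℕ) (a : ℕ → ℂ) :
    ∃ y, IsSobolev p l y ∧ (∀ j < p, nderiv l j y t = a j) ∧ ∀ j < p, nderiv l j y s = 0 := by
  obtain ⟨f, hf, hft, hfs⟩ := exists_contDiff_jet hts p a
  have hud := uniqueDiffOn_Icc_zero hl
  refine ⟨f, .of_contDiff hl p hf, fun j hj => ?_, fun j _ => ?_⟩
  · rw [← hft j hj]
    exact iteratedDerivWithin_eq_iteratedDeriv hud (hf j).contDiffAt ht
  · rw [← hfs j]
    exact iteratedDerivWithin_eq_iteratedDeriv hud (hf j).contDiffAt hs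

/-! ### The boundary form and the separated conditions -/

theorem J_mulVec (k : ℕ) (b : Fin k → ℂ) (i : Fin k) :
    (J k).mulVec b i = (-1) ^ (i : ℕ) * b i.rev := by
  rw [Matrix.mulVec, dotProduct, Finset.sum_eq_single i.rev]
  · rw [J, Matrix.of_apply, if_pos (by rw [Fin.val_rev]; omega)]
  · intro j _ hj
    rw [J, Matrix.of_apply, if_neg, zero_mul]
    intro h
    apply hj
    apply Fin.ext
    rw [Fin.val_rev]; omega
  · simp

/-- The boundary form in terms of the boundary vectors `Y₀` and `J Y₁`. -/
theorem lagrangeForm_two_mul (k : ℕ) (l : ℝ) (u v : ℝ → ℂ) (x : ℝ) :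
    lagrangeForm l (2 * k) u v x =
      star ((J k).mulVec (Y1 k l u x)) ⬝ᵥ Y0 k l v x -
        star (Y0 k l u x) ⬝ᵥ (J k).mulVec (Y1 k l v x) := by
  rw [lagrangeForm, two_mul, Finset.sum_range_add, sub_eq_add_neg]
  congr 1
  · rw [Finset.sum_range, dotProduct]
    refine Finset.sum_congr rfl fun i _ => ?_
    have e : k + k - 1 - (i : ℕ) = k + (i.rev : ℕ) := by rw [Fin.val_rev]; omega
    simp [J_mulVec, Y0, Y1, e]
    ring
  · rw [Finset.sum_range, dotProduct, ← Finset.sum_neg_distrib]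
    -- The upper half of the sum pairs orders k - 1 - i and k + i; reversal puts it in the order of
    -- Y₀, and k + i and k - 1 - i have opposite parity.
    refine Fintype.sum_equiv Fin.revPerm _ _ fun i => ?_
    have e : k + k - 1 - (k + (i : ℕ)) = (i.rev : ℕ) := by rw [Fin.val_rev]; omega
    have e2 : (-1 : ℂ) ^ (k + (i : ℕ)) = -(-1) ^ (i.rev : ℕ) := by
      have h : k + (i : ℕ) = (i.rev : ℕ) + 2 * i + 1 := by rw [Fin.val_rev]; omega
      rw [h, pow_succ, pow_add, pow_mul]; simp
    simp only [Fin.revPerm_apply, J_mulVec, Y0, Y1, e, e2, Pi.star_apply, Fin.rev_rev,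
      Complex.star_def]
    ring

/-- Only `u` is assumed to satisfy the condition, so what remains measures the defect of `v`. This
serves both symmetry and its converse. -/
theorem lagrangeForm_eq_of_bc {k : ℕ} {l : ℝ} {B : Matrix (Fin k) (Fin k) ℂ} (hB : B.IsHermitian)
    {u v : ℝ → ℂ} {x : ℝ} (hu : (J k).mulVec (Y1 k l u x) = B.mulVec (Y0 k l u x)) :
    lagrangeForm l (2 * k) u v x =
      star (Y0 k l u x) ⬝ᵥ (B.mulVec (Y0 k l v x) - (J k).mulVec (Y1 k l v x)) := by
  rw [lagrangeForm_two_mul, hu, Matrix.star_mulVec, hB.eq, dotProduct_sub,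
    Matrix.dotProduct_mulVec _ B]

/-- Every vector is the value of `Y₀` at one endpoint for a function satisfying the boundary
condition there with zero data at the other endpoint. -/
theorem exists_isSobolev_bc {k : ℕ} {l : ℝ} (hl : 0 < l) {t s : ℝ} (ht : t ∈ Icc 0 l)
    (hs : s ∈ Icc 0 l) (hts : t ≠ s) (B : Matrix (Fin k) (Fin k) ℂ) (a : Fin k → ℂ) :
    ∃ y, IsSobolev (2 * k) l y ∧ Y0 k l y t = a ∧
      (J k).mulVec (Y1 k l y t) = B.mulVec (Y0 k l y t) ∧ ∀ j < 2 * k, nderiv l j y s = 0 := by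
  -- The orders from k on carry the solution Y₁ of J Y₁ = B a, as J reverses the entries with signs.
  -- The final 0 is never reached for orders below 2k.
  obtain ⟨y, hy, hyt, hys⟩ := exists_isSobolev_jet hl ht hs hts (2 * k) (fun j =>
    if h : j < k then a ⟨j, h⟩ else if h : j - k < k then
      (-1) ^ ((Fin.rev ⟨j - k, h⟩ : Fin k) : ℕ) * B.mulVec a (Fin.rev ⟨j - k, h⟩) else 0)
  have h0 : Y0 k l y t = a := by
    funext i
    rw [Y0, hyt i (by omega), dif_pos i.2]
  refine ⟨y, hy, h0, ?_, hys⟩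
  rw [h0]
  funext i
  have hk : ¬ k + (i.rev : ℕ) < k := by omega
  rw [J_mulVec, Y1, hyt _ (by omega), dif_neg hk, dif_pos (by omega)]
  have e : (⟨k + (i.rev : ℕ) - k, by omega⟩ : Fin k) = i.rev := Fin.ext (by simp)
  rw [e, Fin.rev_rev, ← mul_assoc, ← pow_add, ← two_mul, pow_mul]
  simp

theorem Y0_eq_zero {k : ℕ} {l : ℝ} {y : ℝ → ℂ} {x : ℝ} (h : ∀ j < 2 * k, nderiv l j y x = 0) :
    Y0 k l y x = 0 := by
  funext i; exact h i (by omega)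

theorem Y1_eq_zero {k : ℕ} {l : ℝ} {y : ℝ → ℂ} {x : ℝ} (h : ∀ j < 2 * k, nderiv l j y x = 0) :
    Y1 k l y x = 0 := by
  funext i; exact h (k + i) (by omega)

theorem bc_of_zero {k : ℕ} {l : ℝ} {y : ℝ → ℂ} {x : ℝ} (B : Matrix (Fin k) (Fin k) ℂ)
    (h : ∀ j < 2 * k, nderiv l j y x = 0) :
    (J k).mulVec (Y1 k l y x) = B.mulVec (Y0 k l y x) := by
  rw [Y0_eq_zero h, Y1_eq_zero h, Matrix.mulVec_zero, Matrix.mulVec_zero]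

/-- A Sobolev function that is symmetric against the domain satisfies the boundary conditions. -/
theorem separatedBC_of_forall {k : ℕ} {l : ℝ} (hl : 0 < l) {B₀ Bl : Matrix (Fin k) (Fin k) ℂ}
    (hB₀ : B₀.IsHermitian) (hBl : Bl.IsHermitian) {v : ℝ → ℂ}
    (h : ∀ y, InDomain k l B₀ Bl y →
      lagrangeForm l (2 * k) y v l - lagrangeForm l (2 * k) y v 0 = 0) :
    SeparatedBC k l B₀ Bl v := by
  have m0 : (0 : ℝ) ∈ Icc 0 l := ⟨le_rfl, hl.le⟩
  have ml : l ∈ Icc 0 l := ⟨hl.le, le_rfl⟩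
  constructor
  · refine (sub_eq_zero.1 (dotProduct_star_self_eq_zero.1 ?_)).symm
    -- Taking Y₀(y) to be the defect of `v` turns the boundary form into the squared norm of that
    -- defect.
    obtain ⟨y, hy, hya, hyb, hyl⟩ := exists_isSobolev_bc hl m0 ml hl.ne B₀
      (B₀.mulVec (Y0 k l v 0) - (J k).mulVec (Y1 k l v 0))
    have h1 := h y ⟨hy, hyb, bc_of_zero Bl hyl⟩
    rw [lagrangeForm_eq_zero hyl, zero_sub, neg_eq_zero, lagrangeForm_eq_of_bc hB₀ hyb, hya] at h1
    exact h1
  · refine (sub_eq_zero.1 (dotProduct_star_self_eq_zero.1 ?_)).symm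
    obtain ⟨y, hy, hya, hyb, hy0⟩ := exists_isSobolev_bc hl ml m0 hl.ne' Bl
      (Bl.mulVec (Y0 k l v l) - (J k).mulVec (Y1 k l v l))
    have h1 := h y ⟨hy, bc_of_zero B₀ hy0, hyb⟩
    rw [lagrangeForm_eq_zero hy0, sub_zero, lagrangeForm_eq_of_bc hBl hyb, hya] at h1
    exact h1

/-! ### Symmetry, the adjoint domain and density -/

theorem InDomain.symmetric {k : ℕ} {l : ℝ} (hl : 0 < l) {B₀ Bl : Matrix (Fin k) (Fin k) ℂ}
    (hB₀ : B₀.IsHermitian) (hBl : Bl.IsHermitian) {u v : ℝ → ℂ} (hu : InDomain k l B₀ Bl u)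
    (hv : InDomain k l B₀ Bl v) :
    ∫ x, conj (nderiv l (2 * k) u x) * v x ∂(intervalMeasure l) =
      ∫ x, conj (u x) * nderiv l (2 * k) v x ∂(intervalMeasure l) := by
  rw [lagrange_identity hl hu.sobolev hv.sobolev, lagrangeForm_eq_of_bc hB₀ hu.bc.1,
    lagrangeForm_eq_of_bc hBl hu.bc.2, hv.bc.1, hv.bc.2, pow_mul]
  simp

theorem neg_I_pow_two_mul (k : ℕ) : (-Complex.I) ^ (2 * k) = (-1) ^ k := by
  rw [pow_mul]; simp

theorem inner_separatedOp_left {k : ℕ} {l : ℝ} {hl : 0 < l} {B₀ Bl : Matrix (Fin k) (Fin k) ℂ}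
    (f : (separatedOp k hl B₀ Bl).domain) {y : ℝ → ℂ} (hy : InDomain k l B₀ Bl y)
    (h : (f : L2 l) =ᵐ[intervalMeasure l] y) {g : L2 l} {v : ℝ → ℂ}
    (hg : g =ᵐ[intervalMeasure l] v) :
    inner ℂ (separatedOp k hl B₀ Bl f) g =
      (-1) ^ k * ∫ x, conj (nderiv l (2 * k) y x) * v x ∂(intervalMeasure l) := by
  rw [inner_eq_integral (separatedOp_apply f hy h) hg, ← integral_const_mul]
  refine integral_congr_ae (Filter.Eventually.of_forall fun x => ?_)
  simp only [neg_I_pow_two_mul, map_mul, map_pow, map_neg, map_one]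
  ring

theorem isFormalAdjoint_separatedOp {k : ℕ} {l : ℝ} (hl : 0 < l)
    {B₀ Bl : Matrix (Fin k) (Fin k) ℂ} (hB₀ : B₀.IsHermitian) (hBl : Bl.IsHermitian) :
    (separatedOp k hl B₀ Bl).IsFormalAdjoint (separatedOp k hl B₀ Bl) := by
  rintro f g
  obtain ⟨u, hu, hfu⟩ := f.2
  obtain ⟨v, hv, hgv⟩ := g.2
  rw [inner_separatedOp_left f hu hfu hgv, hu.symmetric hl hB₀ hBl hv,
    inner_eq_integral hfu (separatedOp_apply g hv hgv), ← integral_const_mul]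
  refine integral_congr_ae (Filter.Eventually.of_forall fun x => ?_)
  simp only [neg_I_pow_two_mul]
  ring

theorem InDomain.of_zero_data {k : ℕ} {l : ℝ} {B₀ Bl : Matrix (Fin k) (Fin k) ℂ} {y : ℝ → ℂ}
    (hy : IsSobolev (2 * k) l y) (h0 : ∀ j < 2 * k, nderiv l j y 0 = 0)
    (hl : ∀ j < 2 * k, nderiv l j y l = 0) : InDomain k l B₀ Bl y :=
  ⟨hy, bc_of_zero B₀ h0, bc_of_zero Bl hl⟩

/-- The element of the domain represented by a Sobolev function. -/
def InDomain.toDomain {k : ℕ} {l : ℝ} (hl : 0 < l) {B₀ Bl : Matrix (Fin k) (Fin k) ℂ} {y : ℝ → ℂ}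
    (hy : InDomain k l B₀ Bl y) : (separatedOp k hl B₀ Bl).domain :=
  ⟨(hy.sobolev.memLp_self hl).toLp y, y, hy, MemLp.coeFn_toLp _⟩

theorem InDomain.coeFn_toDomain {k : ℕ} {l : ℝ} (hl : 0 < l) {B₀ Bl : Matrix (Fin k) (Fin k) ℂ}
    {y : ℝ → ℂ} (hy : InDomain k l B₀ Bl y) :
    ((hy.toDomain hl : (separatedOp k hl B₀ Bl).domain) : L2 l) =ᵐ[intervalMeasure l] y :=
  MemLp.coeFn_toLp (hy.sobolev.memLp_self hl)

/-- Density of the domain is not assumed, so that the lemma can prove density as well as bound the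
adjoint domain. -/
theorem exists_inDomain_of_mem_adjoint {k : ℕ} (hk : 1 ≤ k) {l : ℝ} (hl : 0 < l)
    {B₀ Bl : Matrix (Fin k) (Fin k) ℂ} (hB₀ : B₀.IsHermitian) (hBl : Bl.IsHermitian) {z w : L2 l}
    (h : ∀ f : (separatedOp k hl B₀ Bl).domain,
      inner ℂ (separatedOp k hl B₀ Bl f) z = inner ℂ (f : L2 l) w) :
    ∃ v, InDomain k l B₀ Bl v ∧ z =ᵐ[intervalMeasure l] v ∧
      nderiv l (2 * k) v =ᵐ[intervalMeasure l] fun x => (-1) ^ k * w x := by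
  have hz : ∀ y, InDomain k l B₀ Bl y →
      ∫ x, conj (nderiv l (2 * k) y x) * z x ∂(intervalMeasure l) =
        (-1) ^ (2 * k) * ∫ x, conj (y x) * ((-1 : ℂ) ^ k • w) x ∂(intervalMeasure l) := by
    intro y hy
    have h1 := h (hy.toDomain hl)
    rw [inner_separatedOp_left _ hy (hy.coeFn_toDomain hl) (Filter.EventuallyEq.refl _ z),
      inner_eq_integral (hy.coeFn_toDomain hl) (Filter.EventuallyEq.refl _ w)] at h1
    have h2 : ∫ x, conj (y x) * ((-1 : ℂ) ^ k • w) x ∂(intervalMeasure l) =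
        (-1) ^ k * ∫ x, conj (y x) * w x ∂(intervalMeasure l) := by
      rw [← integral_const_mul]
      refine integral_congr_ae ?_
      filter_upwards [Lp.coeFn_smul ((-1 : ℂ) ^ k) w] with x hx
      rw [hx, Pi.smul_apply, smul_eq_mul]
      ring
    rw [h2, ← h1, ← mul_assoc, ← mul_assoc, ← pow_add, ← pow_add, show 2 * k + k + k = 2 * (2 * k) by ring,
      pow_mul]
    simp
  -- Functions with zero data at both ends lie in the domain whatever the boundary matrices are.
  obtain ⟨v, hv, hzv, hvw⟩ := exists_isSobolev_of_weak (p := 2 * k) (by omega) hl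
    (z := z) (w := (-1 : ℂ) ^ k • w) fun y hy h0 hl' => hz y (.of_zero_data hy h0 hl')
  refine ⟨v, ⟨hv, separatedBC_of_forall hl hB₀ hBl fun y hy => ?_⟩, hzv, ?_⟩
  · have h1 := hz y hy
    have h2 : ∫ x, conj (nderiv l (2 * k) y x) * z x ∂(intervalMeasure l) =
        ∫ x, conj (nderiv l (2 * k) y x) * v x ∂(intervalMeasure l) := by
      refine integral_congr_ae ?_
      filter_upwards [hzv] with x hx
      rw [hx]
    have h3 : ∫ x, conj (y x) * ((-1 : ℂ) ^ k • w) x ∂(intervalMeasure l) =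
        ∫ x, conj (y x) * nderiv l (2 * k) v x ∂(intervalMeasure l) := by
      refine integral_congr_ae ?_
      filter_upwards [hvw] with x hx
      rw [hx]
    rw [h2, h3, lagrange_identity hl hy.sobolev hv] at h1
    simpa using h1
  · filter_upwards [hvw, Lp.coeFn_smul ((-1 : ℂ) ^ k) w] with x h1 h2
    rw [h1, h2, Pi.smul_apply, smul_eq_mul]

theorem dense_domain_separatedOp {k : ℕ} (hk : 1 ≤ k) {l : ℝ} (hl : 0 < l)
    {B₀ Bl : Matrix (Fin k) (Fin k) ℂ} (hB₀ : B₀.IsHermitian) (hBl : Bl.IsHermitian) :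
    Dense ((separatedOp k hl B₀ Bl).domain : Set (L2 l)) := by
  rw [Submodule.dense_iff_topologicalClosure_eq_top, Submodule.topologicalClosure_eq_top_iff,
    Submodule.eq_bot_iff]
  intro w hw
  -- Orthogonality of w to the domain is the adjoint relation with z = 0; then v = 0 almost
  -- everywhere, and so its derivative (-1)ᵏ w vanishes.
  obtain ⟨v, hv, hzv, hvw⟩ := exists_inDomain_of_mem_adjoint hk hl hB₀ hBl (z := 0) (w := w)
    fun f => by rw [inner_zero_right, Submodule.inner_right_of_mem_orthogonal f.2 hw]
  have h0 := nderiv_congr_ae hl hv.sobolev (IsSobolev.zero (2 * k) l)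
    (hzv.symm.trans (Lp.coeFn_zero _ _ _))
  rw [nderiv_zero_fun] at h0
  refine Lp.ext (Filter.EventuallyEq.trans ?_ (Lp.coeFn_zero _ _ _).symm)
  filter_upwards [hvw, h0] with x h1 h2
  rw [h2] at h1
  simpa using h1.symm

end HighOrderOp

end

theorem proposition7p1 (k : ℕ) (hk : 1 ≤ k) (l : ℝ) (hl : 0 < l)
    (B₀ Bl : Matrix (Fin k) (Fin k) ℂ) (hB₀ : B₀.IsHermitian) (hBl : Bl.IsHermitian) :
    IsSelfAdjoint (HighOrderOp.separatedOp k hl B₀ Bl) := by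
  have hd := HighOrderOp.dense_domain_separatedOp hk hl hB₀ hBl
  rw [LinearPMap.isSelfAdjoint_def]
  have hle := (HighOrderOp.isFormalAdjoint_separatedOp hl hB₀ hBl).le_adjoint hd
  -- Symmetry makes the adjoint an extension, so only the inclusion of its domain remains.
  refine (LinearPMap.eq_of_le_of_domain_eq hle (le_antisymm hle.1 fun z hz => ?_)).symm
  obtain ⟨v, hv, hzv, -⟩ := HighOrderOp.exists_inDomain_of_mem_adjoint hk hl hB₀ hBl
    fun f => (LinearPMap.adjoint_isFormalAdjoint hd).symm f ⟨z, hz⟩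
  exact ⟨v, hv, hzv⟩
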